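/- **Language.** Consider the call-by-value lambda calculus with types $\tau ::= \mathbf{int}\mid\mathbf{unit}\mid\alpha\mid\tau_1\times\tau_2\mid\tau_1\to\tau_2\mid\forall\alpha.\tau$, terms $e ::= x\mid n\mid\langle\rangle\mid\langle e,e\rangle\mid\pi_i e\mid\lambda x{:}\tau.e\mid e_1e_2\mid\Lambda\alpha.e\mid e[\tau]$ ($n\in\mathbb Z$) and values $v::= n\mid\langle\rangle\mid\langle v,v\rangle\mid\lambda x{:}\tau.e\mid\Lambda\alpha.e$. Types and terms are taken up to renaming of bound variables. Reduction $\rightarrowtriangle$ is generated by $\pi_i\langle v_1,v_2\rangle\rightarrowtriangle v_i$, $(\lambda x{:}\tau.e)\,v\rightarrowtriangle e[x\mapsto v]$, $(\Lambda\alpha.e)[\tau]\rightarrowtriangle e[\alpha\mapsto\tau]$ inside evaluation contexts $E::=[.]\mid\langle E,e\rangle\mid\langle v,E\rangle\mid\pi_iE\mid E\,e\mid v\,E\mid E[\tau]$; $\rightarrowtriangle^*$ is its reflexive transitive closure. The typing judgment $\Delta,\Gamma\vdash e:\tau$ is the standard (System F) one: in particular, $\Delta,\Gamma\vdash\Lambda\alpha.e:\forall\alpha.\tau$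 if $\Delta,\alpha,\Gamma\vdash e:\tau$, and $\Delta,\Gamma\vdash e[\tau']:\tau[\tau'/\alpha]$ if $\Delta,\Gamma\vdash e:\forall\alpha.\tau$ and $\tau'$ is well-formed in $\Delta$. **Logical relation.** For closed types $\tau_1,\tau_2$ let $\mathrm{Rel}(\tau_1,\tau_2)$ be the set of binary relations between closed values of type $\tau_1$ and closed values of type $\tau_2$. An environment $\rho$ maps type variables to tuples $\langle\tau_1,\tau_2,R\rangle$ with $R\in\mathrm{Rel}(\tau_1,\tau_2)$, and term variables to pairs $\langle v_1,v_2\rangle$ of closed values. Write $\rho_L$, $\rho_R$ for the simultaneous substitutions of first, respectively second, components. Define relations $[\![\tau]\!]_\rho$ on closed values and $[\![\tau]\!]^{ev}_\rho$ on closed terms, by recursion on $\tau$: * $\langle n,n\rangle\in[\![\mathbf{int}]\!]_\rho$ for $n\in\mathbb Z$; $\langle\langle\rangle,\langle\rangle\rangle\in[\![\mathbf{unit}]\!]_\rho$; no other pairs are related at these types; $[\![\alpha]\!]_\rho=R$ if $\rho(\alpha)=\langle\tau_1,\tau_2,R\rangle$; * $[\![\tau_1\times\tau_2]\!]_\rho$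 consists of the $\langle\langle v_1,v_2\rangle,\langle v_1',v_2'\rangle\rangle$ with $\langle v_i,v_i'\rangle\in[\![\tau_i]\!]_\rho$ for $i=1,2$; * $\langle v_1,v_2\rangle\in[\![\tau_1\to\tau_2]\!]_\rho$ iff $\vdash v_1:\rho_L(\tau_1\to\tau_2)$, $\vdash v_2:\rho_R(\tau_1\to\tau_2)$ and $\langle v_1w_1,v_2w_2\rangle\in[\![\tau_2]\!]^{ev}_\rho$ for all $\langle w_1,w_2\rangle\in[\![\tau_1]\!]_\rho$; * $\langle v_1,v_2\rangle\in[\![\forall\alpha.\tau]\!]_\rho$ iff $\vdash v_1:\rho_L(\forall\alpha.\tau)$, $\vdash v_2:\rho_R(\forall\alpha.\tau)$ and $\langle v_1[\tau_1],v_2[\tau_2]\rangle\in[\![\tau]\!]^{ev}_{\rho,\alpha\mapsto\langle\tau_1,\tau_2,R\rangle}$ for all closed $\tau_1,\tau_2$ and all $R\in\mathrm{Rel}(\tau_1,\tau_2)$; * $\langle e_1,e_2\rangle\in[\![\tau]\!]^{ev}_\rho$ iff $\vdash e_1:\rho_L(\tau)$, $\vdash e_2:\rho_R(\tau)$ and there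 are values with $e_1\rightarrowtriangle^*v_1$, $e_2\rightarrowtriangle^*v_2$ and $\langle v_1,v_2\rangle\in[\![\tau]\!]_\rho$. **Encoding.** Let $(\mathcal L,\sqsubseteq)$ be a finite lattice of security levels and let $\mathit{lvl}$ assign a level to every element of a set of inputs. With one type variable $\alpha_l$ for every level $l$ and pairwise distinct term variables, put $\Delta_{NI}=\{\alpha_l\mid l\in\mathcal L\}$ and $$\begin{aligned}\Gamma_{NI}={}&\{x:\alpha_l\to\mathbf{int}\mid x\text{ is an input},\ \mathit{lvl}(x)=l\}\\ &\cup\{\mathrm{comp}_l:\forall\beta_1,\beta_2.(\alpha_l\to\beta_1)\to(\beta_1\to(\alpha_l\to\beta_2))\to\alpha_l\to\beta_2\mid l\in\mathcal L\}\\ &\cup\{\mathrm{convup}_{l,l'}:\forall\beta.(\alpha_l\to\beta)\to(\alpha_{l'}\to\beta)\mid l\sqsubset l'\}\\ &\cup\{\mathrm{wrap}_l:\forall\beta.\beta\to\alpha_l\to\beta\mid l\in\mathcal L\}.\end{aligned}$$ For an observer $\zeta\in\mathcal L$, let $\rho_\zeta(\alpha_l)=\langle\mathbf{unit},\mathbf{unit},\{\langle\langle\rangle,\langle\rangle\rangle\}\rangle$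 if $l\sqsubseteq\zeta$ and $\rho_\zeta(\alpha_l)=\langle\mathbf{unit},\mathbf{unit},\emptyset\rangle$ otherwise. For a type $\tau$ over $\Delta_{NI}$, indistinguishability for $\zeta$ at $\tau$ is $I^\zeta_{NI}[\![\tau]\!]=[\![\tau]\!]_{\rho_\zeta}$ on values and $I^\zeta_{NI}[\![\tau]\!]^{ev}=[\![\tau]\!]^{ev}_{\rho_\zeta}$ on terms. A *full environment for noninterference w.r.t. $\zeta$* is an environment $\rho$ for $\Delta_{NI},\Gamma_{NI}$ that agrees with $\rho_\zeta$ on type variables, maps every input $x$ to a pair in $I^\zeta_{NI}[\![\alpha_{\mathit{lvl}(x)}\to\mathbf{int}]\!]$, and maps every $\mathrm{comp}_l$, $\mathrm{convup}_{l,l'}$, $\mathrm{wrap}_l$ to the pair of two copies of, respectively, $$\Lambda\beta_1,\beta_2.\lambda x{:}\mathbf{unit}\to\beta_1.\lambda f{:}\beta_1\to(\mathbf{unit}\to\beta_2).f(x\,\langle\rangle),\qquad \Lambda\beta.\lambda x{:}\mathbf{unit}\to\beta.x,\qquad \Lambda\beta.\lambda x{:}\beta.\lambda\_{:}\mathbf{unit}.x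 .$$ **Theorem.** If $\Delta_{NI},\Gamma_{NI}\vdash e:\tau$, then for every $\zeta\in\mathcal L$ and every full environment $\rho$ for noninterference w.r.t. $\zeta$, $\langle\rho_L(e),\rho_R(e)\rangle\in I^\zeta_{NI}[\![\tau]\!]^{ev}$. In particular, for $n\ge1$ and levels $l_1,\dots,l_n$, if $\Delta_{NI},\Gamma_{NI}\vdash e:(\alpha_{l_1}\to\mathbf{int})\times\dots\times(\alpha_{l_n}\to\mathbf{int})$, then for all such $\zeta$ and $\rho$, $\langle\rho_L(e),\rho_R(e)\rangle\in I^\zeta_{NI}[\![(\alpha_{l_1}\to\mathbf{int})\times\dots\times(\alpha_{l_n}\to\mathbf{int})]\!]^{ev}$. -/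

import Mathlib

/-!
A call-by-value lambda calculus with integers, unit, products, functions and universally
quantified types, its logical relation, and the monadic encoding of noninterference over a
finite lattice.

Syntax is well scoped: `Ty V` is the type of types whose free type variables are elements of `V`,
and `Tm V X` is the type of terms whose free type variables are elements of `V` and whose free term
variables are elements of `X`. A binder extends the set of variables by `none` (the bound variable),
the other variables being renamed by `some`; so terms are identified up to renaming of bound
variables and substitution is capture avoiding. A typing context `Δ` is the set `V` of type
variables, and well-formedness `Δ ⊢ τ` is built into `τ : Ty V`.
-/

namespace NIEncoding

universe u v u' v'

/-! ### Types -/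

inductive Ty : Type u → Type (u + 1)
  | var {V : Type u} (a : V) : Ty V
  | int {V : Type u} : Ty V
  | unit {V : Type u} : Ty V
  | prod {V : Type u} (τ₁ τ₂ : Ty V) : Ty V
  | arr {V : Type u} (τ₁ τ₂ : Ty V) : Ty V
  | all {V : Type u} (τ : Ty (Option V)) : Ty V

namespace Ty

def rename : {V : Type u} → {W : Type u'} → (V → W) → Ty V → Ty W
  | _, _, f, var a => var (f a)
  | _, _, _, int => int
  | _, _, _, unit => unit
  | _, _, f, prod τ₁ τ₂ => prod (τ₁.rename f) (τ₂.rename f)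
  | _, _, f, arr τ₁ τ₂ => arr (τ₁.rename f) (τ₂.rename f)
  | _, _, f, all τ => all (τ.rename (Option.map f))

/-- A type substitution passed under a binder for a type variable. -/
def lift {V : Type u} {W : Type u'} (δ : V → Ty W) : Option V → Ty (Option W)
  | none => var none
  | some a => (δ a).rename some

/-- Simultaneous substitution `δ(τ)`. -/
def subst : {V : Type u} → {W : Type u'} → (V → Ty W) → Ty V → Ty W
  | _, _, δ, var a => δ a
  | _, _, _, int => int
  | _, _, _, unit => unit
  | _, _, δ, prod τ₁ τ₂ => prod (τ₁.subst δ) (τ₂.subst δ)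
  | _, _, δ, arr τ₁ τ₂ => arr (τ₁.subst δ) (τ₂.subst δ)
  | _, _, δ, all τ => all (τ.subst (lift δ))

/-- `τ[τ'/α]`, where `α` is the innermost type variable. -/
def inst {V : Type u} (τ : Ty (Option V)) (τ' : Ty V) : Ty V :=
  τ.subst fun a => a.elim τ' var

end Ty

/-- Closed types. -/
abbrev CTy : Type 1 := Ty Empty

/-! ### Terms -/

inductive Tm : Type u → Type v → Type (max (u + 1) (v + 1))
  | var {V : Type u} {X : Type v} (x : X) : Tm V X
  | int {V : Type u} {X : Type v} (n : ℤ) : Tm V X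
  | unit {V : Type u} {X : Type v} : Tm V X
  | pair {V : Type u} {X : Type v} (e₁ e₂ : Tm V X) : Tm V X
  | fst {V : Type u} {X : Type v} (e : Tm V X) : Tm V X
  | snd {V : Type u} {X : Type v} (e : Tm V X) : Tm V X
  | lam {V : Type u} {X : Type v} (τ : Ty V) (e : Tm V (Option X)) : Tm V X
  | app {V : Type u} {X : Type v} (e₁ e₂ : Tm V X) : Tm V X
  | tlam {V : Type u} {X : Type v} (e : Tm (Option V) X) : Tm V X
  | tapp {V : Type u} {X : Type v} (e : Tm V X) (τ : Ty V) : Tm V X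

namespace Tm

def rename : {V : Type u} → {X : Type v} → {W : Type u'} → {Y : Type v'} →
    (V → W) → (X → Y) → Tm V X → Tm W Y
  | _, _, _, _, _, g, var x => var (g x)
  | _, _, _, _, _, _, int n => int n
  | _, _, _, _, _, _, unit => unit
  | _, _, _, _, f, g, pair e₁ e₂ => pair (e₁.rename f g) (e₂.rename f g)
  | _, _, _, _, f, g, fst e => fst (e.rename f g)
  | _, _, _, _, f, g, snd e => snd (e.rename f g)
  | _, _, _, _, f, g, lam τ e => lam (τ.rename f) (e.rename f (Option.map g))
  | _, _, _, _, f, g, app e₁ e₂ => app (e₁.rename f g) (e₂.rename f g)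
  | _, _, _, _, f, g, tlam e => tlam (e.rename (Option.map f) g)
  | _, _, _, _, f, g, tapp e τ => tapp (e.rename f g) (τ.rename f)

/-- A term substitution passed under a binder for a term variable. -/
def lift {X : Type v} {W : Type u'} {Y : Type v'} (γ : X → Tm W Y) : Option X → Tm W (Option Y)
  | none => var none
  | some x => (γ x).rename id some

/-- A term substitution passed under a binder for a type variable. -/
def liftTy {X : Type v} {W : Type u'} {Y : Type v'} (γ : X → Tm W Y) : X → Tm (Option W) Y :=
  fun x => (γ x).rename some id

/-- Simultaneous substitution `δγ(e)` of types for type variables and of terms for term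
variables. -/
def subst : {V : Type u} → {X : Type v} → {W : Type u'} → {Y : Type v'} →
    (V → Ty W) → (X → Tm W Y) → Tm V X → Tm W Y
  | _, _, _, _, _, γ, var x => γ x
  | _, _, _, _, _, _, int n => int n
  | _, _, _, _, _, _, unit => unit
  | _, _, _, _, δ, γ, pair e₁ e₂ => pair (e₁.subst δ γ) (e₂.subst δ γ)
  | _, _, _, _, δ, γ, fst e => fst (e.subst δ γ)
  | _, _, _, _, δ, γ, snd e => snd (e.subst δ γ)
  | _, _, _, _, δ, γ, lam τ e => lam (τ.subst δ) (e.subst δ (lift γ))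
  | _, _, _, _, δ, γ, app e₁ e₂ => app (e₁.subst δ γ) (e₂.subst δ γ)
  | _, _, _, _, δ, γ, tlam e => tlam (e.subst (Ty.lift δ) (liftTy γ))
  | _, _, _, _, δ, γ, tapp e τ => tapp (e.subst δ γ) (τ.subst δ)

/-- `e[x ↦ e']`, where `x` is the innermost term variable. -/
def inst {V : Type u} {X : Type v} (e : Tm V (Option X)) (e' : Tm V X) : Tm V X :=
  e.subst Ty.var fun x => x.elim e' var

/-- `e[α ↦ τ]`, where `α` is the innermost type variable. -/
def instTy {V : Type u} {X : Type v} (e : Tm (Option V) X) (τ : Ty V) : Tm V X :=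
  e.subst (fun a => a.elim τ Ty.var) var

end Tm

/-- Closed terms. -/
abbrev CTm : Type 1 := Tm Empty Empty

/-! ### Values, reduction and typing -/

inductive IsValue : {V : Type u} → {X : Type v} → Tm V X → Prop
  | int {V : Type u} {X : Type v} (n : ℤ) : IsValue (Tm.int n : Tm V X)
  | unit {V : Type u} {X : Type v} : IsValue (Tm.unit : Tm V X)
  | pair {V : Type u} {X : Type v} {v₁ v₂ : Tm V X} :
      IsValue v₁ → IsValue v₂ → IsValue (Tm.pair v₁ v₂)
  | lam {V : Type u} {X : Type v} (τ : Ty V) (e : Tm V (Option X)) : IsValue (Tm.lam τ e)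
  | tlam {V : Type u} {X : Type v} (e : Tm (Option V) X) : IsValue (Tm.tlam e)

/-- One step of call-by-value reduction. The congruence rules spell out the evaluation contexts
`E ::= [.] | ⟨E, e⟩ | ⟨v, E⟩ | πᵢ E | E e | v E | E[τ]`. -/
inductive Step {V : Type u} {X : Type v} : Tm V X → Tm V X → Prop
  | fstPair {v₁ v₂ : Tm V X} :
      IsValue v₁ → IsValue v₂ → Step (Tm.fst (Tm.pair v₁ v₂)) v₁
  | sndPair {v₁ v₂ : Tm V X} :
      IsValue v₁ → IsValue v₂ → Step (Tm.snd (Tm.pair v₁ v₂)) v₂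
  | beta {τ : Ty V} {e : Tm V (Option X)} {w : Tm V X} :
      IsValue w → Step (Tm.app (Tm.lam τ e) w) (e.inst w)
  | tbeta {e : Tm (Option V) X} {τ : Ty V} : Step (Tm.tapp (Tm.tlam e) τ) (e.instTy τ)
  | pairL {e₁ e₁' e₂ : Tm V X} : Step e₁ e₁' → Step (Tm.pair e₁ e₂) (Tm.pair e₁' e₂)
  | pairR {w e₂ e₂' : Tm V X} :
      IsValue w → Step e₂ e₂' → Step (Tm.pair w e₂) (Tm.pair w e₂')
  | fst {e e' : Tm V X} : Step e e' → Step (Tm.fst e) (Tm.fst e')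
  | snd {e e' : Tm V X} : Step e e' → Step (Tm.snd e) (Tm.snd e')
  | appL {e₁ e₁' e₂ : Tm V X} : Step e₁ e₁' → Step (Tm.app e₁ e₂) (Tm.app e₁' e₂)
  | appR {w e₂ e₂' : Tm V X} :
      IsValue w → Step e₂ e₂' → Step (Tm.app w e₂) (Tm.app w e₂')
  | tapp {e e' : Tm V X} {τ : Ty V} : Step e e' → Step (Tm.tapp e τ) (Tm.tapp e' τ)

/-- `Δ, Γ ⊢ e : τ`, where `Δ` is the set `V` and `Γ` maps the term variables to types. -/
inductive HasType : {V : Type u} → {X : Type v} → (X → Ty V) → Tm V X → Ty V → Prop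
  | var {V : Type u} {X : Type v} {Γ : X → Ty V} (x : X) : HasType Γ (Tm.var x) (Γ x)
  | int {V : Type u} {X : Type v} {Γ : X → Ty V} (n : ℤ) : HasType Γ (Tm.int n) Ty.int
  | unit {V : Type u} {X : Type v} {Γ : X → Ty V} : HasType Γ Tm.unit Ty.unit
  | pair {V : Type u} {X : Type v} {Γ : X → Ty V} {e₁ e₂ : Tm V X} {τ₁ τ₂ : Ty V} :
      HasType Γ e₁ τ₁ → HasType Γ e₂ τ₂ → HasType Γ (Tm.pair e₁ e₂) (Ty.prod τ₁ τ₂)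
  | fst {V : Type u} {X : Type v} {Γ : X → Ty V} {e : Tm V X} {τ₁ τ₂ : Ty V} :
      HasType Γ e (Ty.prod τ₁ τ₂) → HasType Γ (Tm.fst e) τ₁
  | snd {V : Type u} {X : Type v} {Γ : X → Ty V} {e : Tm V X} {τ₁ τ₂ : Ty V} :
      HasType Γ e (Ty.prod τ₁ τ₂) → HasType Γ (Tm.snd e) τ₂
  | lam {V : Type u} {X : Type v} {Γ : X → Ty V} {e : Tm V (Option X)} {τ₁ τ₂ : Ty V} :
      HasType (fun x : Option X => x.elim τ₁ Γ) e τ₂ → HasType Γ (Tm.lam τ₁ e) (Ty.arr τ₁ τ₂)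
  | app {V : Type u} {X : Type v} {Γ : X → Ty V} {e₁ e₂ : Tm V X} {τ₁ τ₂ : Ty V} :
      HasType Γ e₁ (Ty.arr τ₁ τ₂) → HasType Γ e₂ τ₁ → HasType Γ (Tm.app e₁ e₂) τ₂
  | tlam {V : Type u} {X : Type v} {Γ : X → Ty V} {e : Tm (Option V) X} {τ : Ty (Option V)} :
      HasType (fun x => (Γ x).rename some) e τ → HasType Γ (Tm.tlam e) (Ty.all τ)
  | tapp {V : Type u} {X : Type v} {Γ : X → Ty V} {e : Tm V X} {τ : Ty (Option V)} {τ' : Ty V} :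
      HasType Γ e (Ty.all τ) → HasType Γ (Tm.tapp e τ') (τ.inst τ')

/-- `⊢ e : τ` in the empty contexts. -/
def CHasType (e : CTm) (τ : CTy) : Prop := HasType (fun x : Empty => x.elim) e τ

/-! ### The logical relation -/

/-- A tuple `⟨τ₁, τ₂, R⟩` with `τ₁`, `τ₂` closed types and `R ∈ Rel(τ₁, τ₂)`, that is, `R` is a
binary relation between closed values of type `τ₁` and closed values of type `τ₂`. -/
structure Interp : Type 1 where
  left : CTy
  right : CTy
  rel : CTm → CTm → Prop
  value_of_rel : ∀ {v₁ v₂ : CTm}, rel v₁ v₂ → IsValue v₁ ∧ IsValue v₂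
  type_of_rel : ∀ {v₁ v₂ : CTm}, rel v₁ v₂ → CHasType v₁ left ∧ CHasType v₂ right

/-- `ρ, α ↦ ⟨τ₁, τ₂, R⟩`, where `α` is the innermost type variable. -/
def extend {V : Type u} (ρ : V → Interp) (R : Interp) : Option V → Interp
  | none => R
  | some a => ρ a

/-- Closed terms of types `τ₁` and `τ₂` that reduce to values related by `R`. -/
def evRel (τ₁ τ₂ : CTy) (R : CTm → CTm → Prop) (e₁ e₂ : CTm) : Prop :=
  CHasType e₁ τ₁ ∧ CHasType e₂ τ₂ ∧
    ∃ v₁ v₂ : CTm, IsValue v₁ ∧ IsValue v₂ ∧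
      Relation.ReflTransGen Step e₁ v₁ ∧ Relation.ReflTransGen Step e₂ v₂ ∧ R v₁ v₂

/-- `ρ_L(τ)`. -/
def leftTy {V : Type u} (ρ : V → Interp) (τ : Ty V) : CTy := τ.subst fun a => (ρ a).left

/-- `ρ_R(τ)`. -/
def rightTy {V : Type u} (ρ : V → Interp) (τ : Ty V) : CTy := τ.subst fun a => (ρ a).right

/-- The logical relation `⟦τ⟧_ρ` on closed values. -/
def valRel : {V : Type u} → Ty V → (V → Interp) → CTm → CTm → Prop
  | _, .var a, ρ, v₁, v₂ => (ρ a).rel v₁ v₂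
  | _, .int, _, v₁, v₂ => ∃ n : ℤ, v₁ = Tm.int n ∧ v₂ = Tm.int n
  | _, .unit, _, v₁, v₂ => v₁ = Tm.unit ∧ v₂ = Tm.unit
  | _, .prod τ₁ τ₂, ρ, v₁, v₂ =>
      ∃ w₁ w₁' w₂ w₂' : CTm, v₁ = Tm.pair w₁ w₂ ∧ v₂ = Tm.pair w₁' w₂' ∧
        valRel τ₁ ρ w₁ w₁' ∧ valRel τ₂ ρ w₂ w₂'
  | _, .arr τ₁ τ₂, ρ, v₁, v₂ =>
      IsValue v₁ ∧ IsValue v₂ ∧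
      CHasType v₁ (leftTy ρ (.arr τ₁ τ₂)) ∧ CHasType v₂ (rightTy ρ (.arr τ₁ τ₂)) ∧
      ∀ w₁ w₂ : CTm, valRel τ₁ ρ w₁ w₂ →
        evRel (leftTy ρ τ₂) (rightTy ρ τ₂) (fun e₁ e₂ => valRel τ₂ ρ e₁ e₂)
          (Tm.app v₁ w₁) (Tm.app v₂ w₂)
  | _, .all τ, ρ, v₁, v₂ =>
      IsValue v₁ ∧ IsValue v₂ ∧
      CHasType v₁ (leftTy ρ (.all τ)) ∧ CHasType v₂ (rightTy ρ (.all τ)) ∧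
      ∀ R : Interp,
        evRel (leftTy (extend ρ R) τ) (rightTy (extend ρ R) τ)
          (fun e₁ e₂ => valRel τ (extend ρ R) e₁ e₂)
          (Tm.tapp v₁ R.left) (Tm.tapp v₂ R.right)

/-- The logical relation `⟦τ⟧_ρ^ev` on closed terms. -/
def termRel {V : Type u} (τ : Ty V) (ρ : V → Interp) : CTm → CTm → Prop :=
  evRel (leftTy ρ τ) (rightTy ρ τ) (valRel τ ρ)

/-- An environment maps type variables to tuples `⟨τ₁, τ₂, R⟩` and term variables to pairs of
closed terms. -/
structure Env (V : Type u) (X : Type v) where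
  ty : V → Interp
  tm : X → CTm × CTm

/-- `ρ_L(e)`. -/
def Env.left {V : Type u} {X : Type v} (ρ : Env V X) (e : Tm V X) : CTm :=
  e.subst (fun a => (ρ.ty a).left) (fun x => (ρ.tm x).1)

/-- `ρ_R(e)`. -/
def Env.right {V : Type u} {X : Type v} (ρ : Env V X) (e : Tm V X) : CTm :=
  e.subst (fun a => (ρ.ty a).right) (fun x => (ρ.tm x).2)

/-! ### The encoding of noninterference

The type variable `α_l` is `Ty.var l`, so the typing context `Δ_NI = {α_l | l ∈ L}` is `L`. -/

/-- The term variables of `Γ_NI`: the inputs and the interfaces for computation. -/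
inductive NIVar (L : Type u) [Lattice L] (I : Type v) : Type (max u v)
  | input (x : I)
  | comp (l : L)
  | convup (l l' : L) (h : l < l')
  | wrap (l : L)

/-- `Γ_NI`. -/
def ctxNI {L : Type u} [Lattice L] {I : Type v} (lvl : I → L) : NIVar L I → Ty L
  -- `α_l → int` with `l = lvl x`
  | .input x => .arr (.var (lvl x)) .int
  -- `∀ β₁ β₂, (α_l → β₁) → (β₁ → (α_l → β₂)) → α_l → β₂`
  | .comp l =>
      let α : Ty (Option (Option L)) := .var (some (some l))
      let β₁ : Ty (Option (Option L)) := .var (some none)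
      let β₂ : Ty (Option (Option L)) := .var none
      .all (.all (.arr (.arr α β₁) (.arr (.arr β₁ (.arr α β₂)) (.arr α β₂))))
  -- `∀ β, (α_l → β) → (α_l' → β)`
  | .convup l l' _ =>
      let β : Ty (Option L) := .var none
      .all (.arr (.arr (.var (some l)) β) (.arr (.var (some l')) β))
  -- `∀ β, β → α_l → β`
  | .wrap l =>
      let β : Ty (Option L) := .var none
      .all (.arr β (.arr (.var (some l)) β))

/-- `comp = Λ β₁ β₂. λ x : unit → β₁. λ f : β₁ → (unit → β₂). f (x ⟨⟩)`. -/
def compImpl : CTm :=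
  let β₁ : Ty (Option (Option Empty)) := .var (some none)
  let β₂ : Ty (Option (Option Empty)) := .var none
  .tlam (.tlam (.lam (.arr .unit β₁) (.lam (.arr β₁ (.arr .unit β₂))
    (.app (.var none) (.app (.var (some none)) .unit)))))

/-- `convup = Λ β. λ x : unit → β. x`. -/
def convupImpl : CTm := .tlam (.lam (.arr .unit (.var none)) (.var none))

/-- `wrap = Λ β. λ x : β. λ _ : unit. x`. -/
def wrapImpl : CTm := .tlam (.lam (.var none) (.lam .unit (.var (some none))))

/-- `⟨unit, unit, Full_unit⟩` with `Full_unit = {⟨⟨⟩, ⟨⟩⟩}`. -/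
def fullUnit : Interp where
  left := .unit
  right := .unit
  rel v₁ v₂ := v₁ = .unit ∧ v₂ = .unit
  value_of_rel := by
    rintro _ _ ⟨rfl, rfl⟩
    exact ⟨.unit, .unit⟩
  type_of_rel := by
    rintro _ _ ⟨rfl, rfl⟩
    exact ⟨.unit, .unit⟩

/-- `⟨unit, unit, ∅⟩`. -/
def emptyUnit : Interp where
  left := .unit
  right := .unit
  rel _ _ := False
  value_of_rel h := h.elim
  type_of_rel h := h.elim

open Classical in
/-- The environment for noninterference w.r.t. an observer `ζ` (on type variables). -/
noncomputable def envNI {L : Type u} [Lattice L] (ζ : L) : L → Interp :=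
  fun l => if l ≤ ζ then fullUnit else emptyUnit

/-- Indistinguishability of values of type `τ` for the observer `ζ`. -/
def indVal {L : Type u} [Lattice L] (ζ : L) (τ : Ty L) : CTm → CTm → Prop :=
  valRel τ (envNI ζ)

/-- Indistinguishability of terms of type `τ` for the observer `ζ`. -/
def indTerm {L : Type u} [Lattice L] (ζ : L) (τ : Ty L) : CTm → CTm → Prop :=
  termRel τ (envNI ζ)

/-- `ρ` is a full environment for noninterference w.r.t. the observer `ζ`. -/
structure IsFullEnvNI {L : Type u} [Lattice L] {I : Type v} (lvl : I → L) (ζ : L)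
    (ρ : Env L (NIVar L I)) : Prop where
  ty : ρ.ty = envNI ζ
  input : ∀ x : I,
    indVal ζ (.arr (.var (lvl x)) .int) (ρ.tm (.input x)).1 (ρ.tm (.input x)).2
  comp : ∀ l : L, ρ.tm (.comp l) = (compImpl, compImpl)
  convup : ∀ (l l' : L) (h : l < l'), ρ.tm (.convup l l' h) = (convupImpl, convupImpl)
  wrap : ∀ l : L, ρ.tm (.wrap l) = (wrapImpl, wrapImpl)

/-- The output type `(α_l₁ → int) × … × (α_lₙ → int)` for the nonempty list of levels
`l₁ = l, l₂, …, lₙ`; products of more than two factors associate to the right. -/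
def outputTy {L : Type u} : L → List L → Ty L
  | l, [] => .arr (.var l) .int
  | l, l' :: ls => .prod (.arr (.var l) .int) (outputTy l' ls)

end NIEncoding

open NIEncoding

/-!
Noninterference is an instance of parametricity. The fundamental property of the logical relation
(`HasType.termRel_subst`) says that a well-typed term, closed by two substitutions with related
components, evaluates to related values. So only the substitutions of a full environment have to
be shown related on `Γ_NI`: the inputs are related by assumption, and for the interfaces
`comp`, `convup` and `wrap` this is checked directly (`valRel_compImpl`, `valRel_convupImpl`,
`valRel_wrapImpl`).

The fundamental property is proved by induction on the typing derivation. Its typing part is the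
substitution lemma `HasType.subst`; the case of type application rests on compositionality of the
relation, `valRel_subst`, that is, `⟦τ[τ'/α]⟧_ρ = ⟦τ⟧_{ρ, α ↦ ⟨ρ_L(τ'), ρ_R(τ'), ⟦τ'⟧_ρ⟩}`. The two
binder cases use the substitution calculus for well-scoped syntax.

For the interfaces, the levels not visible to the observer are interpreted by the empty relation.
`convup` is sound because this interpretation is antitone in the level. For `comp` at an invisible
level the relation on results holds vacuously, but the body must still evaluate to a value on both
sides; its termination (`CHasType.exists_value`) is the fundamental property again, for closed
terms.
-/

namespace NIEncoding

universe u₁ u₂ u₃ v₁ v₂ v₃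

/-! ### Substitution calculus for types -/

namespace Ty

theorem rename_rename {V : Type u₁} (τ : Ty V) {W : Type u₂} {U : Type u₃} (f : V → W)
    (g : W → U) : (τ.rename f).rename g = τ.rename (g ∘ f) := by
  induction τ generalizing W U with
  | var | int | unit => rfl
  | prod _ _ ih₁ ih₂ | arr _ _ ih₁ ih₂ => simp only [rename, ih₁, ih₂]
  | all _ ih => simp only [rename, ih, Option.map_comp_map]

theorem rename_id {V : Type u₁} (τ : Ty V) : τ.rename id = τ := by
  induction τ with
  | var | int | unit => rfl
  | prod _ _ ih₁ ih₂ | arr _ _ ih₁ ih₂ => simp only [rename, ih₁, ih₂]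
  | all _ ih => simp only [rename, Option.map_id, ih]

theorem subst_rename {V : Type u₁} (τ : Ty V) {W : Type u₂} {U : Type u₃} (f : V → W)
    (δ : W → Ty U) : (τ.rename f).subst δ = τ.subst (δ ∘ f) := by
  induction τ generalizing W U with
  | var | int | unit => rfl
  | prod _ _ ih₁ ih₂ | arr _ _ ih₁ ih₂ => simp only [rename, subst, ih₁, ih₂]
  | all _ ih =>
    have h : lift δ ∘ Option.map f = lift (δ ∘ f) := by
      funext a; cases a <;> rfl
    simp only [rename, subst, ih, h]

theorem rename_subst {V : Type u₁} (τ : Ty V) {W : Type u₂} {U : Type u₃} (δ : V → Ty W)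
    (g : W → U) : (τ.subst δ).rename g = τ.subst fun a => (δ a).rename g := by
  induction τ generalizing W U with
  | var | int | unit => rfl
  | prod _ _ ih₁ ih₂ | arr _ _ ih₁ ih₂ => simp only [rename, subst, ih₁, ih₂]
  | all _ ih =>
    have h : (fun a => (lift δ a).rename (Option.map g)) = lift fun a => (δ a).rename g := by
      funext a
      cases a with
      | none => rfl
      | some a => simp only [lift, rename_rename]; rfl
    simp only [rename, subst, ih, h]

theorem subst_subst {V : Type u₁} (τ : Ty V) {W : Type u₂} {U : Type u₃} (δ : V → Ty W)
    (ε : W → Ty U) : (τ.subst δ).subst ε = τ.subst fun a => (δ a).subst ε := by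
  induction τ generalizing W U with
  | var | int | unit => rfl
  | prod _ _ ih₁ ih₂ | arr _ _ ih₁ ih₂ => simp only [subst, ih₁, ih₂]
  | all _ ih =>
    have h : (fun a => (lift δ a).subst (lift ε)) = lift fun a => (δ a).subst ε := by
      funext a
      cases a with
      | none => rfl
      | some a => simp only [lift, subst_rename, rename_subst]; rfl
    simp only [subst, ih, h]

theorem subst_var {V : Type u₁} (τ : Ty V) : τ.subst var = τ := by
  induction τ with
  | var | int | unit => rfl
  | prod _ _ ih₁ ih₂ | arr _ _ ih₁ ih₂ => simp only [subst, ih₁, ih₂]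
  | @all V _ ih =>
    have h : lift (var (V := V)) = var := by
      funext a; cases a <;> rfl
    simp only [subst, h, ih]

theorem rename_inst {V : Type u₁} {W : Type u₂} (τ : Ty (Option V)) (τ' : Ty V) (f : V → W) :
    (τ.inst τ').rename f = (τ.rename (Option.map f)).inst (τ'.rename f) := by
  simp only [inst, rename_subst, subst_rename]
  congr 1; funext a; cases a <;> rfl

theorem subst_inst {V : Type u₁} {W : Type u₂} (τ : Ty (Option V)) (τ' : Ty V) (δ : V → Ty W) :
    (τ.inst τ').subst δ = τ.subst fun a => a.elim (τ'.subst δ) δ := by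
  simp only [inst, subst_subst]
  congr 1; funext a; cases a <;> rfl

theorem inst_subst_lift {V : Type u₁} {W : Type u₂} (τ : Ty (Option V)) (τ' : Ty W)
    (δ : V → Ty W) : (τ.subst (lift δ)).inst τ' = τ.subst fun a => a.elim τ' δ := by
  simp only [inst, subst_subst]
  congr 1; funext a
  cases a with
  | none => rfl
  | some a => simp only [lift, subst_rename]; exact subst_var _

end Ty

/-! ### Substitution calculus for terms -/

namespace Tm

theorem rename_rename {V : Type u₁} {X : Type v₁} (e : Tm V X) {W : Type u₂} {Y : Type v₂}
    {U : Type u₃} {Z : Type v₃} (f : V → W) (g : X → Y) (f' : W → U) (g' : Y → Z) :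
    (e.rename f g).rename f' g' = e.rename (f' ∘ f) (g' ∘ g) := by
  induction e generalizing W Y U Z with
  | var | int | unit => rfl
  | pair _ _ ih₁ ih₂ | app _ _ ih₁ ih₂ => simp only [rename, ih₁, ih₂]
  | fst _ ih | snd _ ih => simp only [rename, ih]
  | lam _ _ ih | tlam _ ih | tapp _ _ ih =>
    simp only [rename, ih, Ty.rename_rename, Option.map_comp_map]

theorem subst_rename {V : Type u₁} {X : Type v₁} (e : Tm V X) {W : Type u₂} {Y : Type v₂}
    {U : Type u₃} {Z : Type v₃} (f : V → W) (g : X → Y) (δ : W → Ty U) (γ : Y → Tm U Z) :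
    (e.rename f g).subst δ γ = e.subst (δ ∘ f) (γ ∘ g) := by
  induction e generalizing W Y U Z with
  | var | int | unit => rfl
  | pair _ _ ih₁ ih₂ | app _ _ ih₁ ih₂ => simp only [rename, subst, ih₁, ih₂]
  | fst _ ih | snd _ ih => simp only [rename, subst, ih]
  | lam _ _ ih =>
    have h : lift γ ∘ Option.map g = lift (γ ∘ g) := by
      funext x; cases x <;> rfl
    simp only [rename, subst, ih, Ty.subst_rename, h]
  | tlam _ ih =>
    have h : Ty.lift δ ∘ Option.map f = Ty.lift (δ ∘ f) := by
      funext x; cases x <;> rfl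
    simp only [rename, subst, ih, h]; rfl
  | tapp _ _ ih => simp only [rename, subst, ih, Ty.subst_rename]

theorem rename_subst {V : Type u₁} {X : Type v₁} (e : Tm V X) {W : Type u₂} {Y : Type v₂}
    {U : Type u₃} {Z : Type v₃} (δ : V → Ty W) (γ : X → Tm W Y) (f : W → U) (g : Y → Z) :
    (e.subst δ γ).rename f g =
      e.subst (fun a => (δ a).rename f) (fun x => (γ x).rename f g) := by
  induction e generalizing W Y U Z with
  | var | int | unit => rfl
  | pair _ _ ih₁ ih₂ | app _ _ ih₁ ih₂ => simp only [rename, subst, ih₁, ih₂]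
  | fst _ ih | snd _ ih => simp only [rename, subst, ih]
  | lam _ _ ih =>
    have h : (fun x => (lift γ x).rename f (Option.map g)) =
        lift fun x => (γ x).rename f g := by
      funext x
      cases x with
      | none => rfl
      | some x => simp only [lift, rename_rename]; rfl
    simp only [rename, subst, ih, Ty.rename_subst, h]
  | tlam _ ih =>
    have h : (fun a => (Ty.lift δ a).rename (Option.map f)) =
        Ty.lift fun a => (δ a).rename f := by
      funext a
      cases a with
      | none => rfl
      | some a => simp only [Ty.lift, Ty.rename_rename]; rfl
    have h' : (fun x => (liftTy γ x).rename (Option.map f) g) =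
        liftTy fun x => (γ x).rename f g := by
      funext x
      simp only [liftTy, rename_rename]; rfl
    simp only [rename, subst, ih, h, h']
  | tapp _ _ ih => simp only [rename, subst, ih, Ty.rename_subst]

theorem subst_subst {V : Type u₁} {X : Type v₁} (e : Tm V X) {W : Type u₂} {Y : Type v₂}
    {U : Type u₃} {Z : Type v₃} (δ : V → Ty W) (γ : X → Tm W Y) (δ' : W → Ty U)
    (γ' : Y → Tm U Z) :
    (e.subst δ γ).subst δ' γ' =
      e.subst (fun a => (δ a).subst δ') (fun x => (γ x).subst δ' γ') := by
  induction e generalizing W Y U Z with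
  | var | int | unit => rfl
  | pair _ _ ih₁ ih₂ | app _ _ ih₁ ih₂ => simp only [subst, ih₁, ih₂]
  | fst _ ih | snd _ ih => simp only [subst, ih]
  | lam _ _ ih =>
    have h : (fun x => (lift γ x).subst δ' (lift γ')) =
        lift fun x => (γ x).subst δ' γ' := by
      funext x
      cases x with
      | none => rfl
      | some x =>
        simp only [lift, subst_rename, rename_subst, Function.comp_def, id, Ty.rename_id]
    simp only [subst, ih, Ty.subst_subst, h]
  | tlam _ ih =>
    have h : (fun a => (Ty.lift δ a).subst (Ty.lift δ')) =
        Ty.lift fun a => (δ a).subst δ' := by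
      funext a
      cases a with
      | none => rfl
      | some a => simp only [Ty.lift, Ty.subst_rename, Ty.rename_subst]; rfl
    have h' : (fun x => (liftTy γ x).subst (Ty.lift δ') (liftTy γ')) =
        liftTy fun x => (γ x).subst δ' γ' := by
      funext x
      simp only [liftTy, subst_rename, rename_subst]; rfl
    simp only [subst, ih, h, h']
  | tapp _ _ ih => simp only [subst, ih, Ty.subst_subst]

theorem subst_var {V : Type u₁} {X : Type v₁} (e : Tm V X) : e.subst Ty.var var = e := by
  induction e with
  | var | int | unit => rfl
  | pair _ _ ih₁ ih₂ | app _ _ ih₁ ih₂ => simp only [subst, ih₁, ih₂]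
  | fst _ ih | snd _ ih => simp only [subst, ih]
  | @lam V X _ _ ih =>
    have h : lift (var (V := V) (X := X)) = var := by
      funext x; cases x <;> rfl
    simp only [subst, ih, Ty.subst_var, h]
  | @tlam V X _ ih =>
    have h : Ty.lift (Ty.var (V := V)) = Ty.var := by
      funext a; cases a <;> rfl
    have h' : liftTy (var (V := V) (X := X)) = var := rfl
    simp only [subst, h, h', ih]
  | tapp _ _ ih => simp only [subst, ih, Ty.subst_var]

/-- A closed term is fixed by every substitution. -/
theorem subst_closed (e : CTm) (δ : Empty → CTy) (γ : Empty → CTm) : e.subst δ γ = e := by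
  rw [Subsingleton.elim δ Ty.var, Subsingleton.elim γ var, subst_var]

theorem inst_subst_lift {V : Type u₁} {X : Type v₁} {W : Type u₂} {Y : Type v₂}
    (e : Tm V (Option X)) (δ : V → Ty W) (γ : X → Tm W Y) (w : Tm W Y) :
    (e.subst δ (lift γ)).inst w = e.subst δ fun x => x.elim w γ := by
  simp only [inst, subst_subst, Ty.subst_var]
  congr 1; funext x
  cases x with
  | none => rfl
  | some x => simp only [lift, subst_rename]; exact subst_var _

theorem instTy_subst_lift {V : Type u₁} {X : Type v₁} {W : Type u₂} {Y : Type v₂}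
    (e : Tm (Option V) X) (δ : V → Ty W) (γ : X → Tm W Y) (τ : Ty W) :
    (e.subst (Ty.lift δ) (liftTy γ)).instTy τ = e.subst (fun a => a.elim τ δ) γ := by
  simp only [instTy, subst_subst]
  congr 1
  · funext a
    cases a with
    | none => rfl
    | some a => simp only [Ty.lift, Ty.subst_rename]; exact Ty.subst_var _
  · funext x
    simp only [liftTy, subst_rename]; exact subst_var _

end Tm

/-! ### Typing under substitution -/

theorem HasType.rename {V : Type u₁} {X : Type v₁} {Γ : X → Ty V} {e : Tm V X} {τ : Ty V}
    (h : HasType Γ e τ) {W : Type u₂} {Y : Type v₂} {Γ' : Y → Ty W} (f : V → W) (g : X → Y)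
    (hg : ∀ x, Γ' (g x) = (Γ x).rename f) : HasType Γ' (e.rename f g) (τ.rename f) := by
  induction h generalizing W Y with
  | var x => rw [← hg x]; exact .var _
  | int n => exact .int n
  | unit => exact .unit
  | pair _ _ ih₁ ih₂ => exact .pair (ih₁ f g hg) (ih₂ f g hg)
  | fst _ ih => exact .fst (ih f g hg)
  | snd _ ih => exact .snd (ih f g hg)
  | lam _ ih =>
    refine .lam (ih f (Option.map g) fun x => ?_)
    cases x with
    | none => rfl
    | some x => exact hg x
  | app _ _ ih₁ ih₂ => exact .app (ih₁ f g hg) (ih₂ f g hg)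
  | tlam _ ih =>
    refine .tlam (ih (Option.map f) g fun x => ?_)
    rw [hg, Ty.rename_rename, Ty.rename_rename]; rfl
  | tapp _ ih => rw [Ty.rename_inst]; exact .tapp (ih f g hg)

theorem HasType.subst {V : Type u₁} {X : Type v₁} {Γ : X → Ty V} {e : Tm V X} {τ : Ty V}
    (h : HasType Γ e τ) {W : Type u₂} {Y : Type v₂} {Γ' : Y → Ty W} (δ : V → Ty W)
    (γ : X → Tm W Y) (hγ : ∀ x, HasType Γ' (γ x) ((Γ x).subst δ)) :
    HasType Γ' (e.subst δ γ) (τ.subst δ) := by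
  induction h generalizing W Y with
  | var x => exact hγ x
  | int n => exact .int n
  | unit => exact .unit
  | pair _ _ ih₁ ih₂ => exact .pair (ih₁ δ γ hγ) (ih₂ δ γ hγ)
  | fst _ ih => exact .fst (ih δ γ hγ)
  | snd _ ih => exact .snd (ih δ γ hγ)
  | @lam _ _ _ _ τ₁ _ _ ih =>
    refine .lam (ih δ (Tm.lift γ) fun x => ?_)
    cases x with
    | none => exact .var (Γ := fun x : Option Y => x.elim (τ₁.subst δ) Γ') none
    | some x =>
      have := (hγ x).rename (Γ' := fun x : Option Y => x.elim (τ₁.subst δ) Γ') id some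
        fun x => (Ty.rename_id _).symm
      rwa [Ty.rename_id] at this
  | app _ _ ih₁ ih₂ => exact .app (ih₁ δ γ hγ) (ih₂ δ γ hγ)
  | tlam _ ih =>
    refine .tlam (ih (Ty.lift δ) (Tm.liftTy γ) fun x => ?_)
    have := (hγ x).rename (Γ' := fun x => (Γ' x).rename some) some id fun x => rfl
    rw [Ty.rename_subst] at this
    rwa [Ty.subst_rename]
  | tapp _ ih =>
    rw [Ty.subst_inst, ← Ty.inst_subst_lift]
    exact .tapp (ih δ γ hγ)

end NIEncoding

namespace NIEncoding

universe u₁ u₂ v₁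

/-! ### Compositionality of the logical relation -/

theorem leftTy_extend {V : Type u₁} (ρ : V → Interp) (R : Interp) (τ : Ty (Option V)) :
    leftTy (extend ρ R) τ = (τ.subst (Ty.lift fun a => (ρ a).left)).inst R.left := by
  rw [Ty.inst_subst_lift, leftTy]
  congr 1; funext a; cases a <;> rfl

theorem rightTy_extend {V : Type u₁} (ρ : V → Interp) (R : Interp) (τ : Ty (Option V)) :
    rightTy (extend ρ R) τ = (τ.subst (Ty.lift fun a => (ρ a).right)).inst R.right := by
  rw [Ty.inst_subst_lift, rightTy]
  congr 1; funext a; cases a <;> rfl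

theorem leftTy_rename {V : Type u₁} {W : Type u₂} (ρ : W → Interp) (f : V → W) (τ : Ty V) :
    leftTy ρ (τ.rename f) = leftTy (ρ ∘ f) τ :=
  Ty.subst_rename _ _ _

theorem rightTy_rename {V : Type u₁} {W : Type u₂} (ρ : W → Interp) (f : V → W) (τ : Ty V) :
    rightTy ρ (τ.rename f) = rightTy (ρ ∘ f) τ :=
  Ty.subst_rename _ _ _

theorem extend_comp_map {V : Type u₁} {W : Type u₂} (ρ : W → Interp) (f : V → W) (R : Interp) :
    extend ρ R ∘ Option.map f = extend (ρ ∘ f) R := by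
  funext a; cases a <;> rfl

theorem valRel_rename {V : Type u₁} {W : Type u₂} (τ : Ty V) (f : V → W) (ρ : W → Interp) :
    valRel (τ.rename f) ρ = valRel τ (ρ ∘ f) := by
  induction τ generalizing W with
  | var | int | unit => rfl
  | prod _ _ ih₁ ih₂ =>
    funext v₁ v₂
    simp only [Ty.rename, valRel, ih₁, ih₂]
  | arr _ _ ih₁ ih₂ =>
    funext v₁ v₂
    simp only [Ty.rename, valRel, ih₁, ih₂, ← leftTy_rename, ← rightTy_rename]
  | all _ ih =>
    funext v₁ v₂
    simp only [Ty.rename, valRel, ih, leftTy_rename, rightTy_rename, extend_comp_map,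
      ← leftTy_rename ρ f (.all _), ← rightTy_rename ρ f (.all _)]

theorem valRel_isValue_and_type {V : Type u₁} {τ : Ty V} {ρ : V → Interp} {v₁ v₂ : CTm}
    (h : valRel τ ρ v₁ v₂) :
    (IsValue v₁ ∧ IsValue v₂) ∧ CHasType v₁ (leftTy ρ τ) ∧ CHasType v₂ (rightTy ρ τ) := by
  induction τ generalizing v₁ v₂ with
  | var a => exact ⟨(ρ a).value_of_rel h, (ρ a).type_of_rel h⟩
  | int => obtain ⟨n, rfl, rfl⟩ := h; exact ⟨⟨.int n, .int n⟩, .int n, .int n⟩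
  | unit => obtain ⟨rfl, rfl⟩ := h; exact ⟨⟨.unit, .unit⟩, .unit, .unit⟩
  | prod _ _ ih₁ ih₂ =>
    obtain ⟨w₁, w₁', w₂, w₂', rfl, rfl, h₁, h₂⟩ := h
    obtain ⟨⟨a, b⟩, c, d⟩ := ih₁ h₁
    obtain ⟨⟨a', b'⟩, c', d'⟩ := ih₂ h₂
    exact ⟨⟨.pair a a', .pair b b'⟩, .pair c c', .pair d d'⟩
  | arr => exact ⟨⟨h.1, h.2.1⟩, h.2.2.1, h.2.2.2.1⟩
  | all => exact ⟨⟨h.1, h.2.1⟩, h.2.2.1, h.2.2.2.1⟩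

/-- The tuple `⟨ρ_L(τ), ρ_R(τ), ⟦τ⟧_ρ⟩`, by which a quantified type is instantiated when it is
applied to `τ`. -/
def interp {V : Type u₁} (ρ : V → Interp) (τ : Ty V) : Interp where
  left := leftTy ρ τ
  right := rightTy ρ τ
  rel := valRel τ ρ
  value_of_rel h := (valRel_isValue_and_type h).1
  type_of_rel h := (valRel_isValue_and_type h).2

theorem interp_rename_some {V : Type u₁} (ρ : V → Interp) (R : Interp) (τ : Ty V) :
    interp (extend ρ R) (τ.rename some) = interp ρ τ := by
  simp only [interp, leftTy_rename, rightTy_rename, valRel_rename]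
  rfl

theorem interp_lift {V : Type u₁} {W : Type u₂} (ρ : W → Interp) (δ : V → Ty W) (R : Interp) :
    (fun a => interp (extend ρ R) (Ty.lift δ a)) = extend (fun a => interp ρ (δ a)) R := by
  funext a
  cases a with
  | none => rfl
  | some a => exact interp_rename_some ρ R (δ a)

theorem leftTy_subst {V : Type u₁} {W : Type u₂} (ρ : W → Interp) (δ : V → Ty W) (τ : Ty V) :
    leftTy ρ (τ.subst δ) = leftTy (fun a => interp ρ (δ a)) τ :=
  Ty.subst_subst _ _ _

theorem rightTy_subst {V : Type u₁} {W : Type u₂} (ρ : W → Interp) (δ : V → Ty W) (τ : Ty V) :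
    rightTy ρ (τ.subst δ) = rightTy (fun a => interp ρ (δ a)) τ :=
  Ty.subst_subst _ _ _

/-- Compositionality: substituting types for type variables amounts to interpreting the variables
by the logical relation at these types. -/
theorem valRel_subst {V : Type u₁} {W : Type u₂} (τ : Ty V) (δ : V → Ty W) (ρ : W → Interp) :
    valRel (τ.subst δ) ρ = valRel τ fun a => interp ρ (δ a) := by
  induction τ generalizing W with
  | var | int | unit => rfl
  | prod _ _ ih₁ ih₂ =>
    funext v₁ v₂
    simp only [Ty.subst, valRel, ih₁, ih₂]
  | arr _ _ ih₁ ih₂ =>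
    funext v₁ v₂
    simp only [Ty.subst, valRel, ih₁, ih₂, ← leftTy_subst, ← rightTy_subst]
  | all _ ih =>
    funext v₁ v₂
    simp only [Ty.subst, valRel, ih, leftTy_subst, rightTy_subst, interp_lift,
      ← leftTy_subst ρ δ (.all _), ← rightTy_subst ρ δ (.all _)]

theorem interp_inst {V : Type u₁} (ρ : V → Interp) (τ' : Ty V) :
    (fun a : Option V => interp ρ (a.elim τ' Ty.var)) = extend ρ (interp ρ τ') := by
  funext a; cases a <;> rfl

theorem termRel_inst {V : Type u₁} (ρ : V → Interp) (τ : Ty (Option V)) (τ' : Ty V) :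
    termRel (τ.inst τ') ρ = termRel τ (extend ρ (interp ρ τ')) := by
  rw [termRel, termRel, Ty.inst, leftTy_subst, rightTy_subst, valRel_subst, interp_inst]

/-! ### Evaluation and the logical relation -/

theorem CHasType.inst_of_lam {σ τ₁ τ₂ : CTy} {e : Tm Empty (Option Empty)} {w : CTm}
    (h : CHasType (.lam σ e) (.arr τ₁ τ₂)) (hw : CHasType w τ₁) : CHasType (e.inst w) τ₂ := by
  cases h with | lam h =>
  rw [← Ty.subst_var τ₂]
  refine h.subst _ _ fun x => ?_
  rw [Ty.subst_var]
  rcases x with _ | x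
  · exact hw
  · exact x.elim

theorem CHasType.instTy_of_tlam {τ : Ty (Option Empty)} {e : Tm (Option Empty) Empty}
    (h : CHasType (.tlam e) (.all τ)) (τ' : CTy) : CHasType (e.instTy τ') (τ.inst τ') := by
  cases h with | tlam h =>
  exact h.subst _ _ fun x => x.elim

theorem termRel_of_valRel {V : Type u₁} {τ : Ty V} {ρ : V → Interp} {v₁ v₂ : CTm}
    (h : valRel τ ρ v₁ v₂) : termRel τ ρ v₁ v₂ :=
  ⟨(valRel_isValue_and_type h).2.1, (valRel_isValue_and_type h).2.2, v₁, v₂,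
    (valRel_isValue_and_type h).1.1, (valRel_isValue_and_type h).1.2, .refl, .refl, h⟩

/-- The relation on terms is closed under expansion to well-typed terms. -/
theorem termRel_of_steps {V : Type u₁} {τ : Ty V} {ρ : V → Interp} {e₁ e₂ e₁' e₂' : CTm}
    (t₁ : CHasType e₁ (leftTy ρ τ)) (t₂ : CHasType e₂ (rightTy ρ τ))
    (s₁ : Relation.ReflTransGen Step e₁ e₁') (s₂ : Relation.ReflTransGen Step e₂ e₂')
    (h : termRel τ ρ e₁' e₂') : termRel τ ρ e₁ e₂ := by
  obtain ⟨-, -, v₁, v₂, h₁, h₂, s₁', s₂', h⟩ := h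
  exact ⟨t₁, t₂, v₁, v₂, h₁, h₂, s₁.trans s₁', s₂.trans s₂', h⟩

theorem termRel_app {V : Type u₁} {τ₁ τ₂ : Ty V} {ρ : V → Interp} {e₁ e₂ e₁' e₂' : CTm}
    (h : termRel (.arr τ₁ τ₂) ρ e₁ e₂) (h' : termRel τ₁ ρ e₁' e₂') :
    termRel τ₂ ρ (.app e₁ e₁') (.app e₂ e₂') := by
  obtain ⟨t₁, t₂, v₁, v₂, i₁, i₂, s₁, s₂, h⟩ := h
  obtain ⟨t₁', t₂', w₁, w₂, -, -, s₁', s₂', h'⟩ := h'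
  refine termRel_of_steps (.app t₁ t₁') (.app t₂ t₂') ?_ ?_ (h.2.2.2.2 w₁ w₂ h')
  · exact (s₁.lift (Tm.app · e₁') fun _ _ => .appL).trans
      (s₁'.lift (Tm.app v₁) fun _ _ => .appR i₁)
  · exact (s₂.lift (Tm.app · e₂') fun _ _ => .appL).trans
      (s₂'.lift (Tm.app v₂) fun _ _ => .appR i₂)

/-- Related polymorphic terms may be instantiated at different types on the two sides, related by any
`R`. -/
theorem termRel_tapp {V : Type u₁} {τ : Ty (Option V)} {ρ : V → Interp} {e₁ e₂ : CTm}
    (h : termRel (.all τ) ρ e₁ e₂) (R : Interp) :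
    termRel τ (extend ρ R) (.tapp e₁ R.left) (.tapp e₂ R.right) := by
  obtain ⟨t₁, t₂, v₁, v₂, i₁, i₂, s₁, s₂, h⟩ := h
  refine termRel_of_steps ?_ ?_ (s₁.lift (Tm.tapp · R.left) fun _ _ => .tapp)
    (s₂.lift (Tm.tapp · R.right) fun _ _ => .tapp) (h.2.2.2.2 R)
  · rw [leftTy_extend]; exact .tapp t₁
  · rw [rightTy_extend]; exact .tapp t₂

theorem valRel_lam {V : Type u₁} {τ₁ τ₂ : Ty V} {ρ : V → Interp} {σ₁ σ₂ : CTy}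
    {e₁ e₂ : Tm Empty (Option Empty)}
    (t₁ : CHasType (.lam σ₁ e₁) (leftTy ρ (.arr τ₁ τ₂)))
    (t₂ : CHasType (.lam σ₂ e₂) (rightTy ρ (.arr τ₁ τ₂)))
    (h : ∀ w₁ w₂, valRel τ₁ ρ w₁ w₂ → CHasType (e₁.inst w₁) (leftTy ρ τ₂) →
      CHasType (e₂.inst w₂) (rightTy ρ τ₂) → termRel τ₂ ρ (e₁.inst w₁) (e₂.inst w₂)) :
    valRel (.arr τ₁ τ₂) ρ (.lam σ₁ e₁) (.lam σ₂ e₂) := by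
  refine ⟨.lam _ _, .lam _ _, t₁, t₂, fun w₁ w₂ hw => ?_⟩
  obtain ⟨⟨i₁, i₂⟩, t₁', t₂'⟩ := valRel_isValue_and_type hw
  exact termRel_of_steps (.app t₁ t₁') (.app t₂ t₂') (.single (.beta i₁)) (.single (.beta i₂))
    (h w₁ w₂ hw (t₁.inst_of_lam t₁') (t₂.inst_of_lam t₂'))

theorem valRel_tlam {V : Type u₁} {τ : Ty (Option V)} {ρ : V → Interp}
    {e₁ e₂ : Tm (Option Empty) Empty}
    (t₁ : CHasType (.tlam e₁) (leftTy ρ (.all τ))) (t₂ : CHasType (.tlam e₂) (rightTy ρ (.all τ)))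
    (h : ∀ R : Interp, CHasType (e₁.instTy R.left) (leftTy (extend ρ R) τ) →
      CHasType (e₂.instTy R.right) (rightTy (extend ρ R) τ) →
      termRel τ (extend ρ R) (e₁.instTy R.left) (e₂.instTy R.right)) :
    valRel (.all τ) ρ (.tlam e₁) (.tlam e₂) := by
  refine ⟨.tlam _, .tlam _, t₁, t₂, fun R => ?_⟩
  have hl := leftTy_extend ρ R τ
  have hr := rightTy_extend ρ R τ
  refine termRel_of_steps ?_ ?_ (.single .tbeta) (.single .tbeta) (h R ?_ ?_)
  · rw [hl]; exact .tapp t₁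
  · rw [hr]; exact .tapp t₂
  · rw [hl]; exact t₁.instTy_of_tlam _
  · rw [hr]; exact t₂.instTy_of_tlam _

/-! ### Parametricity -/

/-- The fundamental property of the logical relation: a well-typed term is related to itself under
related closing substitutions. -/
theorem HasType.termRel_subst {V : Type u₁} {X : Type v₁} {Γ : X → Ty V} {e : Tm V X} {τ : Ty V}
    (h : HasType Γ e τ) (ρ : V → Interp) (γ₁ γ₂ : X → CTm)
    (hγ : ∀ x, valRel (Γ x) ρ (γ₁ x) (γ₂ x)) :
    termRel τ ρ (e.subst (fun a => (ρ a).left) γ₁) (e.subst (fun a => (ρ a).right) γ₂) := by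
  -- The typing part holds for every subterm by the substitution lemma.
  have typed {V : Type u₁} {X : Type v₁} {Γ : X → Ty V} {e : Tm V X} {τ : Ty V}
      (h : HasType Γ e τ) (ρ : V → Interp) (γ₁ γ₂ : X → CTm)
      (hγ : ∀ x, valRel (Γ x) ρ (γ₁ x) (γ₂ x)) :
      CHasType (e.subst (fun a => (ρ a).left) γ₁) (leftTy ρ τ) ∧
        CHasType (e.subst (fun a => (ρ a).right) γ₂) (rightTy ρ τ) :=
    ⟨h.subst _ _ fun x => (valRel_isValue_and_type (hγ x)).2.1,
      h.subst _ _ fun x => (valRel_isValue_and_type (hγ x)).2.2⟩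
  induction h with
  | var x => exact termRel_of_valRel (hγ x)
  | int n => exact termRel_of_valRel ⟨n, rfl, rfl⟩
  | unit => exact termRel_of_valRel ⟨rfl, rfl⟩
  | pair h₁ h₂ ih₁ ih₂ =>
    obtain ⟨t₁, t₂⟩ := typed (h₁.pair h₂) ρ γ₁ γ₂ hγ
    obtain ⟨-, -, v₁, v₂, i₁, i₂, s₁, s₂, r⟩ := ih₁ ρ γ₁ γ₂ hγ
    obtain ⟨-, -, w₁, w₂, j₁, j₂, s₁', s₂', r'⟩ := ih₂ ρ γ₁ γ₂ hγ
    refine ⟨t₁, t₂, .pair v₁ w₁, .pair v₂ w₂, .pair i₁ j₁, .pair i₂ j₂, ?_, ?_,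
      _, _, _, _, rfl, rfl, r, r'⟩
    · exact (s₁.lift (Tm.pair · _) fun _ _ => .pairL).trans
        (s₁'.lift (Tm.pair v₁) fun _ _ => .pairR i₁)
    · exact (s₂.lift (Tm.pair · _) fun _ _ => .pairL).trans
        (s₂'.lift (Tm.pair v₂) fun _ _ => .pairR i₂)
  | fst h ih =>
    obtain ⟨t₁, t₂⟩ := typed h.fst ρ γ₁ γ₂ hγ
    obtain ⟨-, -, _, _, i₁, i₂, s₁, s₂, v₁, v₂, w₁, w₂, rfl, rfl, r, -⟩ := ih ρ γ₁ γ₂ hγ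
    cases i₁ with | pair a b => cases i₂ with | pair c d =>
    exact ⟨t₁, t₂, v₁, v₂, a, c, (s₁.lift Tm.fst fun _ _ => .fst).tail (.fstPair a b),
      (s₂.lift Tm.fst fun _ _ => .fst).tail (.fstPair c d), r⟩
  | snd h ih =>
    obtain ⟨t₁, t₂⟩ := typed h.snd ρ γ₁ γ₂ hγ
    obtain ⟨-, -, _, _, i₁, i₂, s₁, s₂, v₁, v₂, w₁, w₂, rfl, rfl, -, r⟩ := ih ρ γ₁ γ₂ hγ
    cases i₁ with | pair a b => cases i₂ with | pair c d =>
    exact ⟨t₁, t₂, w₁, w₂, b, d, (s₁.lift Tm.snd fun _ _ => .snd).tail (.sndPair a b),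
      (s₂.lift Tm.snd fun _ _ => .snd).tail (.sndPair c d), r⟩
  | lam h ih =>
    obtain ⟨t₁, t₂⟩ := typed h.lam ρ γ₁ γ₂ hγ
    refine termRel_of_valRel (valRel_lam t₁ t₂ fun w₁ w₂ hw _ _ => ?_)
    rw [Tm.inst_subst_lift, Tm.inst_subst_lift]
    refine ih ρ _ _ fun x => ?_
    cases x with
    | none => exact hw
    | some x => exact hγ x
  | app h₁ h₂ ih₁ ih₂ => exact termRel_app (ih₁ ρ γ₁ γ₂ hγ) (ih₂ ρ γ₁ γ₂ hγ)
  | tlam h ih =>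
    obtain ⟨t₁, t₂⟩ := typed h.tlam ρ γ₁ γ₂ hγ
    refine termRel_of_valRel (valRel_tlam t₁ t₂ fun R _ _ => ?_)
    rw [Tm.instTy_subst_lift, Tm.instTy_subst_lift]
    have := ih (extend ρ R) γ₁ γ₂ fun x => by rw [valRel_rename]; exact hγ x
    convert this using 2 <;> funext a <;> cases a <;> rfl
  | tapp h ih =>
    rw [termRel_inst]
    exact termRel_tapp (ih ρ γ₁ γ₂ hγ) (interp ρ _)

/-- Evaluation of closed well-typed terms terminates, with a value of the same type. -/
theorem CHasType.exists_value {e : CTm} {τ : CTy} (h : CHasType e τ) :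
    ∃ v, IsValue v ∧ CHasType v τ ∧ Relation.ReflTransGen Step e v := by
  obtain ⟨-, -, v, _, i, -, s, -, r⟩ :=
    HasType.termRel_subst h (fun a => a.elim) (fun x => x.elim) (fun x => x.elim) fun x => x.elim
  rw [Tm.subst_closed] at s
  have t := (valRel_isValue_and_type r).2.1
  rw [leftTy, Subsingleton.elim (fun a : Empty => _) Ty.var, Ty.subst_var] at t
  exact ⟨v, i, t, s⟩

end NIEncoding

namespace NIEncoding

universe u₁ v₁

/-! ### The interfaces for computation -/

theorem CHasType.compImpl : CHasType compImpl (.all (.all (.arr (.arr .unit (.var (some none)))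
    (.arr (.arr (.var (some none)) (.arr .unit (.var none))) (.arr .unit (.var none)))))) :=
  .tlam (.tlam (.lam (.lam (.app (τ₁ := .var (some none)) (.var none)
    (.app (τ₁ := .unit) (.var (some none)) .unit)))))

theorem CHasType.convupImpl : CHasType convupImpl
    (.all (.arr (.arr .unit (.var none)) (.arr .unit (.var none)))) :=
  .tlam (.lam (.var none))

theorem CHasType.wrapImpl : CHasType wrapImpl
    (.all (.arr (.var none) (.arr .unit (.var none)))) :=
  .tlam (.lam (.lam (.var (some none))))

theorem inst_rename_some (w u : CTm) : (w.rename id some).inst u = w := by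
  rw [Tm.inst, Tm.subst_rename, Tm.subst_closed]

variable {L : Type u₁} [Lattice L]

theorem envNI_left (ζ l : L) : (envNI ζ l).left = .unit := by
  unfold envNI; split <;> rfl

theorem envNI_right (ζ l : L) : (envNI ζ l).right = .unit := by
  unfold envNI; split <;> rfl

theorem envNI_rel {ζ l : L} {u₁ u₂ : CTm} :
    (envNI ζ l).rel u₁ u₂ ↔ l ≤ ζ ∧ u₁ = .unit ∧ u₂ = .unit := by
  unfold envNI
  split <;> rename_i h <;> simp [h, fullUnit, emptyUnit]

variable {I : Type v₁} (lvl : I → L) (ζ : L)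

/-- If `l` is visible to the observer, `comp_l` applies related functions to related arguments.
Otherwise no two values are related at `α_l`, so that every two values of the result type are
related, and all that matters is that `f (x ⟨⟩)` terminates. -/
theorem valRel_compImpl (l : L) :
    valRel (ctxNI lvl (.comp l)) (envNI ζ) compImpl compImpl := by
  refine valRel_tlam ?_ ?_ fun R t₁ t₂ => termRel_of_valRel (valRel_tlam t₁ t₂ fun S t₁ t₂ =>
    termRel_of_valRel (valRel_lam t₁ t₂ fun x₁ x₂ hx t₁ t₂ =>
    termRel_of_valRel (valRel_lam t₁ t₂ fun f₁ f₂ hf t₁ t₂ => ?_)))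
  · simp only [leftTy, Ty.subst, Ty.lift, Ty.rename, envNI_left]
    exact CHasType.compImpl
  · simp only [rightTy, Ty.subst, Ty.lift, Ty.rename, envNI_right]
    exact CHasType.compImpl
  by_cases h : l ≤ ζ
  · change termRel _ _ (.app f₁ (.app ((x₁.rename id some).inst f₁) .unit))
      (.app f₂ (.app ((x₂.rename id some).inst f₂) .unit))
    rw [inst_rename_some, inst_rename_some]
    refine termRel_app (termRel_of_valRel hf) (termRel_app (termRel_of_valRel hx)
      (termRel_of_valRel ?_))
    exact envNI_rel.2 ⟨h, rfl, rfl⟩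
  · obtain ⟨v₁, i₁, t₁', s₁⟩ := t₁.exists_value
    obtain ⟨v₂, i₂, t₂', s₂⟩ := t₂.exists_value
    exact termRel_of_steps t₁ t₂ s₁ s₂ (termRel_of_valRel
      ⟨i₁, i₂, t₁', t₂', fun _ _ hu => (h (envNI_rel.1 hu).1).elim⟩)

/-- Values related at the higher level `α_l'` are related at the lower level `α_l`. -/
theorem valRel_convupImpl (l l' : L) (h : l < l') :
    valRel (ctxNI lvl (.convup l l' h)) (envNI ζ) convupImpl convupImpl := by
  refine valRel_tlam ?_ ?_ fun R t₁ t₂ => termRel_of_valRel (valRel_lam t₁ t₂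
    fun x₁ x₂ hx t₁ t₂ => termRel_of_valRel ⟨hx.1, hx.2.1, t₁, t₂, fun u₁ u₂ hu => ?_⟩)
  · simp only [leftTy, Ty.subst, Ty.lift, Ty.rename, envNI_left]
    exact CHasType.convupImpl
  · simp only [rightTy, Ty.subst, Ty.lift, Ty.rename, envNI_right]
    exact CHasType.convupImpl
  obtain ⟨hζ, rfl, rfl⟩ := envNI_rel.1 hu
  exact hx.2.2.2.2 _ _ (envNI_rel.2 ⟨h.le.trans hζ, rfl, rfl⟩)

theorem valRel_wrapImpl (l : L) :
    valRel (ctxNI lvl (.wrap l)) (envNI ζ) wrapImpl wrapImpl := by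
  refine valRel_tlam ?_ ?_ fun R t₁ t₂ => termRel_of_valRel (valRel_lam t₁ t₂
    fun x₁ x₂ hx t₁ t₂ => termRel_of_valRel (valRel_lam t₁ t₂ fun u₁ u₂ _ _ _ => ?_))
  · simp only [leftTy, Ty.subst, Ty.lift, Ty.rename, envNI_left]
    exact CHasType.wrapImpl
  · simp only [rightTy, Ty.subst, Ty.lift, Ty.rename, envNI_right]
    exact CHasType.wrapImpl
  change termRel _ _ ((x₁.rename id some).inst u₁) ((x₂.rename id some).inst u₂)
  rw [inst_rename_some, inst_rename_some]
  exact termRel_of_valRel hx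

/-- In a full environment every variable of `Γ_NI` is mapped to related values. -/
theorem IsFullEnvNI.valRel {lvl : I → L} {ζ : L} {ρ : Env L (NIVar L I)}
    (h : IsFullEnvNI lvl ζ ρ) (x : NIVar L I) :
    valRel (ctxNI lvl x) ρ.ty (ρ.tm x).1 (ρ.tm x).2 := by
  rw [h.ty]
  cases x with
  | input x => exact h.input x
  | comp l => rw [h.comp]; exact valRel_compImpl lvl ζ l
  | convup l l' hl => rw [h.convup]; exact valRel_convupImpl lvl ζ l l' hl
  | wrap l => rw [h.wrap]; exact valRel_wrapImpl lvl ζ l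

/-- A well-typed term over `Γ_NI` is indistinguishable from itself in every full environment. -/
theorem indTerm_of_hasType {lvl : I → L} {e : Tm L (NIVar L I)} {τ : Ty L}
    (he : HasType (ctxNI lvl) e τ) {ζ : L} {ρ : Env L (NIVar L I)} (h : IsFullEnvNI lvl ζ ρ) :
    indTerm ζ τ (ρ.left e) (ρ.right e) := by
  rw [indTerm, ← h.ty]
  exact he.termRel_subst ρ.ty _ _ h.valRel

end NIEncoding

theorem mainTheorem5 {L : Type*} [Lattice L] [Finite L] {I : Type*} (lvl : I → L) :
    (∀ (e : Tm L (NIVar L I)) (τ : Ty L), HasType (ctxNI lvl) e τ →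
      ∀ (ζ : L) (ρ : Env L (NIVar L I)), IsFullEnvNI lvl ζ ρ →
        indTerm ζ τ (ρ.left e) (ρ.right e)) ∧
    (∀ (l : L) (ls : List L) (e : Tm L (NIVar L I)), HasType (ctxNI lvl) e (outputTy l ls) →
      ∀ (ζ : L) (ρ : Env L (NIVar L I)), IsFullEnvNI lvl ζ ρ →
        indTerm ζ (outputTy l ls) (ρ.left e) (ρ.right e)) := by
  exact ⟨fun _ _ he _ _ h => indTerm_of_hasType he h,
    fun _ _ _ he _ _ h => indTerm_of_hasType he h⟩
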